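/- Let $n\ge 1$, let $f:\mathbb R^n\to\mathbb R$ be convex and bounded below, and let $\partial f$ be its (Clarke) subdifferential, $\partial f(x)=\{g: f^\circ(x;s)\ge g^Ts\ \forall s\}$ with $f^\circ(x;s)=\limsup_{\bar x\to x,\,t\searrow0}\frac{f(\bar x+ts)-f(\bar x)}{t}$. Let $\|\cdot\|$ be any norm on $\mathbb R^n$ with dual norm $\|\gamma\|_*=\sup\{\gamma^Tt:\|t\|\le1\}$. Let $\bar H\succ0$ be symmetric with smallest and largest eigenvalues $\lambda_{\min},\lambda_{\max}$, let $\alpha\in(0,1)$, $\eta\in(0,\lambda_{\min}]$, $\theta\in[\lambda_{\max},\infty)$, $x_1\in\mathbb R^n$, $W_1\succ0$ symmetric, $\delta_1\in(0,\infty)$, $\tau\in(0,1)$ and $\upsilon_1,\upsilon_2,\upsilon_3>0$. Consider the following algorithm (SVANO with SVANO-Bundle-Step). For $k=1,2,\dots$: 1. (Step computation.) Set $x_{k,1}=x_k$ and choose $g_{k,1}\in\partial f(x_{k,1})$. For $m=1,2,\dots$: let $G_{k,m}=[g_{k,1}\ \cdots\ g_{k,m}]$, let $b_{k,j}=f(x_{k,j})+g_{k,j}^T(x_k-x_{k,j})$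 for $j\le m$, and let $(\omega_{k,m},\gamma_{k,m})$ be any solution of $$\max_{\omega\in\mathbb R^m_{\ge0},\ \mathbf 1^T\omega=1,\ \gamma\in\mathbb R^n}\ -\tfrac12(G_{k,m}\omega+\gamma)^TW_k(G_{k,m}\omega+\gamma)+b_k^T\omega-\delta_k\|\gamma\|_*;$$ set $x_{k,m+1}=x_k-W_k(G_{k,m}\omega_{k,m}+\gamma_{k,m})$ and choose $g_{k,m+1}\in\partial f(x_{k,m+1})$. With $l_{k,m}(x)=\max_{1\le j\le m}\{f(x_{k,j})+g_{k,j}^T(x-x_{k,j})\}$: if $l_{k,m}(x_{k,m+1})=f(x_k)$, terminate the algorithm; otherwise, if $f(x_k)-f(x_{k,m+1})\ge\alpha\,(f(x_k)-l_{k,m}(x_{k,m+1}))$, leave the inner loop with $G_k=G_{k,m}$, $(\omega_k,\gamma_k)=(\omega_{k,m},\gamma_{k,m})$, $s_k=-W_k(G_k\omega_k+\gamma_k)$ and $x_{k+1}=x_{k,m+1}=x_k+s_k$. 2. (Matrix update.) Choose any $y_k\in\mathbb R^n$, let $\beta_k$ be the smallest $\beta\in[0,1]$ such that $v=\beta\bar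 Hs_k+(1-\beta)y_k$ satisfies $\eta\le s_k^Tv/\|s_k\|_2^2$ and $\|v\|_2^2/s_k^Tv\le\theta$, let $v_k$ be this $v$ for $\beta=\beta_k$, and set $$W_{k+1}=\Big(I-\frac{v_ks_k^T}{s_k^Tv_k}\Big)^TW_k\Big(I-\frac{v_ks_k^T}{s_k^Tv_k}\Big)+\frac{s_ks_k^T}{s_k^Tv_k}.$$ 3. (Radius update.) Set $\delta_{k+1}=\tau\delta_k$ if $\max\{\upsilon_1\|G_k\omega_k+\gamma_k\|_2,\ \upsilon_2\|s_k\|_2,\ \upsilon_3\|G_k\omega_k\|_2\}\le\delta_k$, and $\delta_{k+1}=\delta_k$ otherwise. Then, for every run of the algorithm, either some iterate $x_k$ that is reached is a minimizer of $f$; or every inner loop ends with a step after finitely many iterations (so infinitely many iterates $x_k$ are produced), the sequence $\{\delta_k\}$ is nonincreasing with $\delta_k\to0$, the set $\mathcal K'=\{k:\delta_{k+1}=\tau\delta_k\}$ is infinite, $$\lim_{k\in\mathcal K',\,k\to\infty}\|G_k\omega_k\|_2=0,$$ and every limit point of $\{x_k\}_{k\in\mathcal K'}$ is a minimizer of $f$.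 -/

import Mathlib

open Filter Topology

noncomputable section

namespace SVANO

/-- The space `ℝⁿ` with the Euclidean norm. -/
abbrev Vec (n : ℕ) : Type := EuclideanSpace ℝ (Fin n)

/-- The linear action `u ↦ W u` of a real square matrix on `ℝⁿ`. -/
def act {n : ℕ} (W : Matrix (Fin n) (Fin n) ℝ) (u : Vec n) : Vec n :=
  WithLp.toLp 2 (W.mulVec u.ofLp)

/-- Clarke's generalized directional derivative
`f°(x; s) = limsup_{z → x, t ↘ 0} (f (z + t s) - f z) / t`, as an extended real. -/
def clarkeDeriv {n : ℕ} (f : Vec n → ℝ) (x s : Vec n) : EReal :=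
  limsup (fun q : Vec n × ℝ => (((f (q.1 + q.2 • s) - f q.1) / q.2 : ℝ) : EReal))
    (𝓝 x ×ˢ 𝓝[>] (0 : ℝ))

/-- Clarke's subdifferential `∂f(x) = {g : f°(x; s) ≥ gᵀ s for all s}`. -/
def subdiff {n : ℕ} (f : Vec n → ℝ) (x : Vec n) : Set (Vec n) :=
  {g | ∀ s : Vec n, ((inner ℝ g s : ℝ) : EReal) ≤ clarkeDeriv f x s}

/-- The norm dual to `N`: `‖γ‖_* = sup {γᵀ t : N t ≤ 1}`. -/
def dualNorm {n : ℕ} (N : Seminorm ℝ (Vec n)) (γ : Vec n) : ℝ :=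
  sSup ((fun t : Vec n => (inner ℝ γ t : ℝ)) '' {t | N t ≤ 1})

/-! ### The step computation (inner loop)

Inner indices start at `0`: in inner iteration `m` the bundle consists of the points
`pt 0, …, pt m`, and the trial point computed from it is `pt (m + 1)`. -/

/-- The quantities produced by one call of the step procedure: trial points, subgradients,
and the dual variables `(ω, γ)` of each inner iteration.  Values at inner iterations that
are not reached carry no meaning. -/
structure Bundle (n : ℕ) where
  pt : ℕ → Vec n
  g : ℕ → Vec n
  ω : (m : ℕ) → Fin (m + 1) → ℝ
  γ : ℕ → Vec n

namespace Bundle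

variable {n : ℕ}

/-- The combination `G ω = ∑ⱼ ωⱼ gⱼ`, where `G` has the columns `g 0, …, g m`. -/
def comb (B : Bundle n) (m : ℕ) (w : Fin (m + 1) → ℝ) : Vec n :=
  ∑ j : Fin (m + 1), w j • B.g j

/-- The cutting-plane model `l(z) = max_{j ≤ m} (f(pt j) + (g j)ᵀ (z - pt j))`. -/
def model (B : Bundle n) (f : Vec n → ℝ) (m : ℕ) (z : Vec n) : ℝ :=
  Finset.univ.sup' Finset.univ_nonempty
    (fun j : Fin (m + 1) => f (B.pt j) + inner ℝ (B.g j) (z - B.pt j))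

/-- The objective of the dual subproblem at `(w, c)`:
`-½ (G w + c)ᵀ W (G w + c) + bᵀ w - δ ‖c‖_*` with `bⱼ = f(pt j) + (g j)ᵀ (x - pt j)`. -/
def dualObj (B : Bundle n) (f : Vec n → ℝ) (N : Seminorm ℝ (Vec n)) (x : Vec n)
    (W : Matrix (Fin n) (Fin n) ℝ) (δ : ℝ) (m : ℕ) (q : (Fin (m + 1) → ℝ) × Vec n) : ℝ :=
  -(1 / 2) * inner ℝ (B.comb m q.1 + q.2) (act W (B.comb m q.1 + q.2))
    + ∑ j : Fin (m + 1), (f (B.pt j) + inner ℝ (B.g j) (x - B.pt j)) * q.1 j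
    - δ * dualNorm N q.2

/-- The vector `G ω + γ` of inner iteration `m`. -/
def dir (B : Bundle n) (m : ℕ) : Vec n := B.comb m (B.ω m) + B.γ m

/-- The termination test of inner iteration `m`: the model value at the new trial point
equals `f x`. -/
def Stops (B : Bundle n) (f : Vec n → ℝ) (x : Vec n) (m : ℕ) : Prop :=
  B.model f m (B.pt (m + 1)) = f x

/-- The sufficient decrease test of inner iteration `m`. -/
def Descends (B : Bundle n) (f : Vec n → ℝ) (α : ℝ) (x : Vec n) (m : ℕ) : Prop :=
  f x - f (B.pt (m + 1)) ≥ α * (f x - B.model f m (B.pt (m + 1)))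

/-- Inner iteration `m` is entered: no earlier inner iteration has left the loop. -/
def Enters (B : Bundle n) (f : Vec n → ℝ) (α : ℝ) (x : Vec n) (m : ℕ) : Prop :=
  ∀ i < m, ¬ B.Stops f x i ∧ ¬ B.Descends f α x i

/-- The step procedure returns a step in inner iteration `m`. -/
def ReturnsAt (B : Bundle n) (f : Vec n → ℝ) (α : ℝ) (x : Vec n) (m : ℕ) : Prop :=
  B.Enters f α x m ∧ ¬ B.Stops f x m ∧ B.Descends f α x m

/-- The step procedure returns a step, after finitely many inner iterations. -/
def Returns (B : Bundle n) (f : Vec n → ℝ) (α : ℝ) (x : Vec n) : Prop :=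
  ∃ m, B.ReturnsAt f α x m

/-- The inner iteration in which a step is returned (the only one with `ReturnsAt`);
meaningful only if `Returns` holds. -/
def returnIndex (B : Bundle n) (f : Vec n → ℝ) (α : ℝ) (x : Vec n) : ℕ :=
  sInf {m | B.ReturnsAt f α x m}

/-- `B` records a call of the step procedure at the iterate `x`, with inverse Hessian
approximation `W` and trust region radius `δ`.  Nothing is required of inner iterations that
are not entered; the loop may return, terminate, or go on forever. -/
structure IsStepRun (B : Bundle n) (f : Vec n → ℝ) (N : Seminorm ℝ (Vec n)) (α : ℝ)
    (x : Vec n) (W : Matrix (Fin n) (Fin n) ℝ) (δ : ℝ) : Prop where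
  pt_zero : B.pt 0 = x
  g_zero : B.g 0 ∈ subdiff f (B.pt 0)
  weights : ∀ m, B.Enters f α x m → B.ω m ∈ stdSimplex ℝ (Fin (m + 1))
  dual : ∀ m, B.Enters f α x m →
    IsMaxOn (B.dualObj f N x W δ m) (stdSimplex ℝ (Fin (m + 1)) ×ˢ Set.univ) (B.ω m, B.γ m)
  pt_succ : ∀ m, B.Enters f α x m → B.pt (m + 1) = x - act W (B.dir m)
  g_succ : ∀ m, B.Enters f α x m → B.g (m + 1) ∈ subdiff f (B.pt (m + 1))

end Bundle

/-! ### The outer loop -/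

/-- The inputs of the algorithm. -/
structure Params (n : ℕ) where
  /-- the norm that defines the trust region -/
  N : Seminorm ℝ (Vec n)
  Hbar : Matrix (Fin n) (Fin n) ℝ
  lmin : ℝ
  lmax : ℝ
  α : ℝ
  η : ℝ
  θ : ℝ
  x₁ : Vec n
  W₁ : Matrix (Fin n) (Fin n) ℝ
  δ₁ : ℝ
  τ : ℝ
  υ₁ : ℝ
  υ₂ : ℝ
  υ₃ : ℝ

/-- The requirements on the inputs of the algorithm. -/
structure Params.Valid {n : ℕ} (P : Params n) : Prop where
  norm_def : ∀ z, P.N z = 0 → z = 0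
  Hbar_pos : P.Hbar.PosDef
  lmin_eig : IsLeast (spectrum ℝ P.Hbar) P.lmin
  lmax_eig : IsGreatest (spectrum ℝ P.Hbar) P.lmax
  α_mem : P.α ∈ Set.Ioo (0 : ℝ) 1
  η_mem : P.η ∈ Set.Ioc 0 P.lmin
  θ_mem : P.lmax ≤ P.θ
  W₁_pos : P.W₁.PosDef
  δ₁_pos : 0 < P.δ₁
  τ_mem : P.τ ∈ Set.Ioo (0 : ℝ) 1
  υ₁_pos : 0 < P.υ₁
  υ₂_pos : 0 < P.υ₂
  υ₃_pos : 0 < P.υ₃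

/-- The two bounds required of the pair `(s, v)`. -/
def Bounds {n : ℕ} (η θ : ℝ) (s v : Vec n) : Prop :=
  η ≤ inner ℝ s v / ‖s‖ ^ 2 ∧ ‖v‖ ^ 2 / inner ℝ s v ≤ θ

/-- The update
`(I - v sᵀ / sᵀv)ᵀ W (I - v sᵀ / sᵀv) + s sᵀ / sᵀv` of the inverse Hessian approximation. -/
def updateW {n : ℕ} (W : Matrix (Fin n) (Fin n) ℝ) (s v : Vec n) :
    Matrix (Fin n) (Fin n) ℝ :=
  (1 - (inner ℝ s v : ℝ)⁻¹ • Matrix.vecMulVec v.ofLp s.ofLp).transpose * W *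
      (1 - (inner ℝ s v : ℝ)⁻¹ • Matrix.vecMulVec v.ofLp s.ofLp)
    + (inner ℝ s v : ℝ)⁻¹ • Matrix.vecMulVec s.ofLp s.ofLp

/-- The quantities produced by the algorithm; outer iterations are numbered from `0`.  Values
at outer iterations that are not reached carry no meaning. -/
structure Trace (n : ℕ) where
  x : ℕ → Vec n
  W : ℕ → Matrix (Fin n) (Fin n) ℝ
  δ : ℕ → ℝ
  B : ℕ → Bundle n
  y : ℕ → Vec n
  β : ℕ → ℝ

namespace Trace

variable {n : ℕ}

/-- Outer iteration `k` is reached: every earlier call of the step procedure returned a step. -/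
def Reached (T : Trace n) (f : Vec n → ℝ) (P : Params n) (k : ℕ) : Prop :=
  ∀ i < k, (T.B i).Returns f P.α (T.x i)

/-- The inner iteration in which the step of outer iteration `k` is returned. -/
def last (T : Trace n) (f : Vec n → ℝ) (P : Params n) (k : ℕ) : ℕ :=
  (T.B k).returnIndex f P.α (T.x k)

/-- The vector `G_k ω_k`. -/
def Gω (T : Trace n) (f : Vec n → ℝ) (P : Params n) (k : ℕ) : Vec n :=
  (T.B k).comb (T.last f P k) ((T.B k).ω (T.last f P k))

/-- The vector `γ_k`. -/
def γ (T : Trace n) (f : Vec n → ℝ) (P : Params n) (k : ℕ) : Vec n :=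
  (T.B k).γ (T.last f P k)

/-- The step `s_k = -W_k (G_k ω_k + γ_k)`. -/
def s (T : Trace n) (f : Vec n → ℝ) (P : Params n) (k : ℕ) : Vec n :=
  -act (T.W k) (T.Gω f P k + T.γ f P k)

/-- The vector `b Hbar s_k + (1 - b) y_k`. -/
def v (T : Trace n) (f : Vec n → ℝ) (P : Params n) (k : ℕ) (b : ℝ) : Vec n :=
  b • act P.Hbar (T.s f P k) + (1 - b) • T.y k

/-- `T` records a run of the algorithm on `f` with inputs `P`.  The run goes on from outer
iteration `k` to `k + 1` exactly when the step procedure of iteration `k` returns a step. -/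
structure IsRun (T : Trace n) (f : Vec n → ℝ) (P : Params n) : Prop where
  x_zero : T.x 0 = P.x₁
  W_zero : T.W 0 = P.W₁
  δ_zero : T.δ 0 = P.δ₁
  step : ∀ k, T.Reached f P k → (T.B k).IsStepRun f P.N P.α (T.x k) (T.W k) (T.δ k)
  x_succ : ∀ k, T.Reached f P (k + 1) → T.x (k + 1) = T.x k + T.s f P k
  β_least : ∀ k, T.Reached f P (k + 1) →
    IsLeast {b ∈ Set.Icc (0 : ℝ) 1 | Bounds P.η P.θ (T.s f P k) (T.v f P k b)} (T.β k)
  W_succ : ∀ k, T.Reached f P (k + 1) →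
    T.W (k + 1) = updateW (T.W k) (T.s f P k) (T.v f P k (T.β k))
  δ_succ : ∀ k, T.Reached f P (k + 1) →
    T.δ (k + 1) =
      if max (max (P.υ₁ * ‖T.Gω f P k + T.γ f P k‖) (P.υ₂ * ‖T.s f P k‖))
          (P.υ₃ * ‖T.Gω f P k‖) ≤ T.δ k
      then P.τ * T.δ k else T.δ k

/-- The set `K'` of outer iterations in which the trust region radius shrinks. -/
def shrinkSet (T : Trace n) (P : Params n) : Set ℕ :=
  {k | T.δ (k + 1) = P.τ * T.δ k}

end Trace

end SVANO

end

namespace SVANO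

variable {n : ℕ}

/-! Suppose no reached iterate minimizes `f`; write `d = G ω + γ`, `s = -W d`, `D = dᵀ W d`.
First-order optimality of the dual subproblem (`dual_stationary`) says that `s` lies in the trust
region, that `γ = 0` when `s` is strictly inside it, and that `G ω` is a subgradient of the
cutting-plane model at `x + s`. Hence the predicted decrease is at least `D`, and at a non-minimizer
it stays above a positive constant.

An infinite inner loop would have bounded trial points and bounded subgradients, hence two trial
points so close that the cut at the earlier one is nearly exact at the later one; the descent test
would then hold there (`returns`).

In the outer loop, `f (x k)` decreases and is bounded below, so the predicted decrease and `D` tend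
to `0`. No uniform bound on `W k` is used to pass from `D` to `d` and `s`. Instead, the nonnegative
potential `tr W⁻¹ - log det W⁻¹` cannot drop by at least `1` at every late update, so `‖d‖²` and
`‖s‖²` are at most a constant times `D` infinitely often (`exists_frequently_norm_sq_le`). If the
radius were eventually constant, at such an iteration `s` would be interior, `γ` would vanish and
the shrinking test would hold. So the radius shrinks infinitely often and tends to `0`. Along these
iterations `G ω` and `s` tend to `0`, and the subgradient inequality for the model passes to the
limit. -/

theorem act_add (W : Matrix (Fin n) (Fin n) ℝ) (u w : Vec n) :
    act W (u + w) = act W u + act W w := by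
  ext i; simp [act, Matrix.mulVec_add]

theorem act_smul (W : Matrix (Fin n) (Fin n) ℝ) (c : ℝ) (u : Vec n) :
    act W (c • u) = c • act W u := by
  ext i; simp [act, Matrix.mulVec_smul]

theorem act_mul (A B : Matrix (Fin n) (Fin n) ℝ) (u : Vec n) :
    act (A * B) u = act A (act B u) := by
  simp [act, Matrix.mulVec_mulVec]

theorem act_one (u : Vec n) : act (1 : Matrix (Fin n) (Fin n) ℝ) u = u := by
  simp [act]

theorem inner_eq_dotProduct (u w : Vec n) : inner ℝ u w = u.ofLp ⬝ᵥ w.ofLp := by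
  simp [EuclideanSpace.inner_eq_star_dotProduct, dotProduct_comm]

theorem inner_act_comm {W : Matrix (Fin n) (Fin n) ℝ} (hW : W.IsHermitian) (u w : Vec n) :
    inner ℝ u (act W w) = inner ℝ w (act W u) := by
  have hT : W.transpose = W := by
    rw [← Matrix.conjTranspose_eq_transpose_of_trivial]
    exact hW
  simp only [inner_eq_dotProduct, act]
  rw [Matrix.dotProduct_mulVec, ← Matrix.mulVec_transpose, hT, dotProduct_comm]

theorem inner_act_pos {W : Matrix (Fin n) (Fin n) ℝ} (hW : W.PosDef) {u : Vec n} (hu : u ≠ 0) :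
    0 < inner ℝ u (act W u) := by
  have := hW.dotProduct_mulVec_pos (x := u.ofLp) (by simpa using hu)
  simpa [inner_eq_dotProduct, act] using this

theorem inner_act_nonneg {W : Matrix (Fin n) (Fin n) ℝ} (hW : W.PosDef) (u : Vec n) :
    0 ≤ inner ℝ u (act W u) := by
  rcases eq_or_ne u 0 with rfl | hu
  · simp
  · exact (inner_act_pos hW hu).le

theorem posDef_of_inner_act_pos {W : Matrix (Fin n) (Fin n) ℝ} (hW : W.IsHermitian)
    (h : ∀ u : Vec n, u ≠ 0 → 0 < inner ℝ u (act W u)) : W.PosDef := by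
  refine Matrix.PosDef.of_dotProduct_mulVec_pos hW fun u hu => ?_
  have := h (WithLp.toLp 2 u) (by simpa using hu)
  simpa [inner_eq_dotProduct, act] using this

/-- The quadratic form `dᵀWd + dᵀu` is bounded below by `-uᵀW⁻¹u / 4`. -/
theorem neg_inner_inv_le {W : Matrix (Fin n) (Fin n) ℝ} (hW : W.PosDef) (d u : Vec n) :
    -(inner ℝ u (act W⁻¹ u) / 4) ≤ inner ℝ d (act W d) + inner ℝ d u := by
  have hdet : IsUnit W.det := hW.det_pos.ne'.isUnit
  have hinv : act W (act W⁻¹ u) = u := by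
    rw [← act_mul, Matrix.mul_nonsing_inv _ hdet, act_one]
  have h := inner_act_nonneg hW (d + (1 / 2 : ℝ) • act W⁻¹ u)
  have h1 : inner ℝ (act W⁻¹ u) (act W d) = inner ℝ d u := by
    rw [inner_act_comm hW.isHermitian, hinv]
  have h2 := real_inner_comm u (act W⁻¹ u)
  simp only [act_add, act_smul, hinv, inner_add_left, inner_add_right, real_inner_smul_left,
    real_inner_smul_right, h1] at h
  linarith

/-! ### Clarke subgradients of a convex function -/

theorem continuous_of_convexOn_univ {f : Vec n → ℝ} (hf : ConvexOn ℝ Set.univ f) :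
    Continuous f :=
  continuousOn_univ.1 (hf.continuousOn isOpen_univ)

theorem slope_le_of_convexOn {f : Vec n → ℝ} (hf : ConvexOn ℝ Set.univ f) (z s : Vec n) {t : ℝ}
    (ht : 0 < t) (ht1 : t ≤ 1) : (f (z + t • s) - f z) / t ≤ f (z + s) - f z := by
  have h := hf.2 (Set.mem_univ z) (Set.mem_univ (z + s)) (sub_nonneg.2 ht1) ht.le (by ring)
  have e : (1 - t) • z + t • (z + s) = z + t • s := by module
  rw [e] at h
  simp only [smul_eq_mul] at h
  rw [div_le_iff₀ ht]
  linarith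

/-- By convexity, slopes with `t ≤ 1` are bounded by the slope at `t = 1`, which is continuous in
the base point; `ε` absorbs its variation. -/
theorem clarkeDeriv_le {f : Vec n → ℝ} (hf : ConvexOn ℝ Set.univ f) (x s : Vec n) {ε : ℝ}
    (hε : 0 < ε) : clarkeDeriv f x s ≤ ((f (x + s) - f x + ε : ℝ) : EReal) := by
  have hc := continuous_of_convexOn_univ hf
  refine limsup_le_of_le (by isBoundedDefault) ?_
  have h1 : ∀ᶠ z in 𝓝 x, f (z + s) - f z < f (x + s) - f x + ε := by
    have : Continuous fun z => f (z + s) - f z := by fun_prop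
    exact this.continuousAt.eventually_lt continuousAt_const (by linarith)
  have h2 : ∀ᶠ t : ℝ in 𝓝[>] (0 : ℝ), 0 < t ∧ t ≤ 1 := Ioc_mem_nhdsGT one_pos
  filter_upwards [h1.prod_mk h2] with q hq
  exact EReal.coe_le_coe_iff.2 ((slope_le_of_convexOn hf _ _ hq.2.1 hq.2.2).trans hq.1.le)

/-- For convex functions, Clarke subgradients satisfy the subgradient inequality. -/
theorem subgradient_le {f : Vec n → ℝ} (hf : ConvexOn ℝ Set.univ f) {x g : Vec n}
    (hg : g ∈ subdiff f x) (z : Vec n) : f x + inner ℝ g (z - x) ≤ f z := by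
  refine le_of_forall_pos_le_add fun ε hε => ?_
  have := EReal.coe_le_coe_iff.1 ((hg (z - x)).trans (clarkeDeriv_le hf x (z - x) hε))
  rw [add_sub_cancel] at this
  linarith

/-- Moving a unit length along `g` raises `f` by at least `‖g‖`, while `f` is bounded on the ball of
radius `R + 1`. -/
theorem exists_norm_subgradient_le {f : Vec n → ℝ} (hf : ConvexOn ℝ Set.univ f) (R : ℝ) :
    ∃ L, 0 ≤ L ∧ ∀ x g, ‖x‖ ≤ R → g ∈ subdiff f x → ‖g‖ ≤ L := by
  obtain ⟨M, hM⟩ := (isCompact_closedBall (0 : Vec n) (R + 1)).exists_bound_of_continuousOn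
    (continuous_of_convexOn_univ hf).continuousOn
  refine ⟨|2 * M|, abs_nonneg _, fun x g hx hg => ?_⟩
  rcases eq_or_ne g 0 with rfl | hg0
  · simp
  have hn : 0 < ‖g‖ := norm_pos_iff.2 hg0
  have h := subgradient_le hf hg (x + ‖g‖⁻¹ • g)
  have hu : ‖‖g‖⁻¹ • g‖ = 1 := by
    rw [norm_smul, norm_inv, norm_norm, inv_mul_cancel₀ hn.ne']
  have h1 := hM x (by simp; linarith)
  have h2 := hM (x + ‖g‖⁻¹ • g) (by
    simp only [mem_closedBall_zero_iff]
    linarith [norm_add_le x (‖g‖⁻¹ • g)])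
  rw [add_sub_cancel_left, real_inner_smul_right, real_inner_self_eq_norm_sq, pow_two,
    inv_mul_cancel_left₀ hn.ne'] at h
  rw [Real.norm_eq_abs] at h1 h2
  linarith [neg_abs_le (f x), le_abs_self (f (x + ‖g‖⁻¹ • g)), le_abs_self (2 * M)]

/-! ### The dual norm -/

theorem exists_norm_le_mul_seminorm {N : Seminorm ℝ (Vec n)} (hN : ∀ z, N z = 0 → z = 0) :
    ∃ C, 0 < C ∧ ∀ z, ‖z‖ ≤ C * N z := by
  have hc : Continuous N := continuous_of_convexOn_univ N.convexOn
  rcases (Metric.sphere (0 : Vec n) 1).eq_empty_or_nonempty with he | hne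
  · refine ⟨1, one_pos, fun z => ?_⟩
    rcases eq_or_ne z 0 with rfl | hz
    · simp
    · have : ‖z‖⁻¹ • z ∈ Metric.sphere (0 : Vec n) 1 := by
        simp [norm_smul, norm_ne_zero_iff.2 hz]
      rw [he] at this
      exact this.elim
  · obtain ⟨u, hu, hmin⟩ := (isCompact_sphere (0 : Vec n) 1).exists_isMinOn hne hc.continuousOn
    have hu1 : ‖u‖ = 1 := by simpa using hu
    have hpos : 0 < N u := lt_of_le_of_ne (apply_nonneg N u) fun h => by
      rw [hN u h.symm, norm_zero] at hu1
      exact zero_ne_one hu1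
    refine ⟨(N u)⁻¹, inv_pos.2 hpos, fun z => ?_⟩
    rcases eq_or_ne z 0 with rfl | hz
    · simp
    · have hzn : 0 < ‖z‖ := norm_pos_iff.2 hz
      have h : N u ≤ N (‖z‖⁻¹ • z) := hmin (by simp [norm_smul, hzn.ne'])
      rw [map_smul_eq_mul, norm_inv, norm_norm, inv_mul_eq_div, le_div_iff₀ hzn] at h
      rw [inv_mul_eq_div, le_div_iff₀ hpos]
      linarith

theorem dualNorm_le {N : Seminorm ℝ (Vec n)} {γ : Vec n} {c : ℝ}
    (h : ∀ t, N t ≤ 1 → inner ℝ γ t ≤ c) : dualNorm N γ ≤ c := by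
  refine csSup_le ⟨_, 0, by simp, rfl⟩ ?_
  rintro _ ⟨t, ht, rfl⟩
  exact h t ht

/-- Definiteness of `N` makes its unit ball bounded, so the real supremum is a genuine one. -/
theorem inner_le_dualNorm {N : Seminorm ℝ (Vec n)} (hN : ∀ z, N z = 0 → z = 0) (γ : Vec n)
    {t : Vec n} (ht : N t ≤ 1) : inner ℝ γ t ≤ dualNorm N γ := by
  obtain ⟨C, hC, hle⟩ := exists_norm_le_mul_seminorm hN
  refine le_csSup ⟨‖γ‖ * C, ?_⟩ ⟨t, ht, rfl⟩
  rintro _ ⟨u, hu, rfl⟩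
  refine (real_inner_le_norm γ u).trans (mul_le_mul_of_nonneg_left ?_ (norm_nonneg _))
  exact (hle u).trans (mul_le_of_le_one_right hC.le hu)

theorem dualNorm_nonneg {N : Seminorm ℝ (Vec n)} (hN : ∀ z, N z = 0 → z = 0) (γ : Vec n) :
    0 ≤ dualNorm N γ := by
  simpa using inner_le_dualNorm hN γ (t := 0) (by simp)

theorem inner_le_dualNorm_mul {N : Seminorm ℝ (Vec n)} (hN : ∀ z, N z = 0 → z = 0)
    (γ t : Vec n) : inner ℝ γ t ≤ dualNorm N γ * N t := by
  rcases eq_or_ne (N t) 0 with h0 | h0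
  · simp [hN t h0]
  · have hpos : 0 < N t := lt_of_le_of_ne (apply_nonneg N t) h0.symm
    have h := inner_le_dualNorm hN γ (t := (N t)⁻¹ • t) (by
      rw [map_smul_eq_mul, Real.norm_of_nonneg (inv_pos.2 hpos).le, inv_mul_cancel₀ h0])
    rwa [real_inner_smul_right, inv_mul_eq_div, div_le_iff₀ hpos] at h

theorem eq_zero_of_dualNorm_eq_zero {N : Seminorm ℝ (Vec n)} (hN : ∀ z, N z = 0 → z = 0)
    {γ : Vec n} (h : dualNorm N γ = 0) : γ = 0 := by
  have := inner_le_dualNorm_mul hN γ γ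
  rw [h, zero_mul] at this
  exact inner_self_eq_zero.1 (this.antisymm real_inner_self_nonneg)

theorem dualNorm_combo_le {N : Seminorm ℝ (Vec n)} (hN : ∀ z, N z = 0 → z = 0)
    (γ γ' : Vec n) {a b : ℝ} (ha : 0 ≤ a) (hb : 0 ≤ b) :
    dualNorm N (a • γ + b • γ') ≤ a * dualNorm N γ + b * dualNorm N γ' := by
  refine dualNorm_le fun t ht => ?_
  rw [inner_add_left, real_inner_smul_left, real_inner_smul_left]
  exact add_le_add (mul_le_mul_of_nonneg_left (inner_le_dualNorm hN _ ht) ha)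
    (mul_le_mul_of_nonneg_left (inner_le_dualNorm hN _ ht) hb)

/-- Norming functionals: the bidual norm is the norm. -/
theorem exists_dualNorm_le_one (N : Seminorm ℝ (Vec n)) (s : Vec n) :
    ∃ γ, dualNorm N γ ≤ 1 ∧ inner ℝ γ s = N s := by
  rcases eq_or_ne s 0 with rfl | hs
  · exact ⟨0, dualNorm_le fun t _ => by simp, by simp⟩
  -- Hahn–Banach: extend `c • s ↦ c * N s` from the line through `s`, keeping it dominated by `N`.
  obtain ⟨φ, hφ, hle⟩ := exists_extension_of_le_sublinear
    (LinearPMap.mkSpanSingleton s (N s) hs) N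
    (fun c hc x => by rw [map_smul_eq_mul, Real.norm_of_nonneg hc.le]) (map_add_le_add N)
    (by
      rintro ⟨y, hy⟩
      obtain ⟨c, rfl⟩ := Submodule.mem_span_singleton.1 hy
      rw [LinearPMap.mkSpanSingleton'_apply, map_smul_eq_mul, RingHom.id_apply, smul_eq_mul]
      exact mul_le_mul_of_nonneg_right (le_abs_self c) (apply_nonneg N s))
  set γ : Vec n := (InnerProductSpace.toDual ℝ (Vec n)).symm (LinearMap.toContinuousLinearMap φ)
  have hγ : ∀ t, inner ℝ γ t = φ t := fun t => by simp [γ]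
  refine ⟨γ, dualNorm_le fun t ht => (hγ t).trans_le ((hle t).trans ht), ?_⟩
  have h := hφ ⟨s, Submodule.mem_span_singleton_self s⟩
  rw [hγ]
  exact h.trans (LinearPMap.mkSpanSingleton_apply ℝ ℝ hs (N s))

/-! ### The cutting-plane model and the dual subproblem -/

namespace Bundle

variable {B : Bundle n} {f : Vec n → ℝ} {N : Seminorm ℝ (Vec n)} {α : ℝ} {x : Vec n}
  {W : Matrix (Fin n) (Fin n) ℝ} {δ : ℝ} {m : ℕ}

theorem comb_combo (B : Bundle n) (m : ℕ) (w w' : Fin (m + 1) → ℝ) (a b : ℝ) :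
    B.comb m (a • w + b • w') = a • B.comb m w + b • B.comb m w' := by
  simp only [comb, Finset.smul_sum, ← Finset.sum_add_distrib]
  refine Finset.sum_congr rfl fun j _ => ?_
  simp only [Pi.add_apply, Pi.smul_apply, smul_eq_mul]
  module

theorem inner_comb (B : Bundle n) (m : ℕ) (w : Fin (m + 1) → ℝ) (u : Vec n) :
    inner ℝ (B.comb m w) u = ∑ j : Fin (m + 1), w j * inner ℝ (B.g j) u := by
  simp only [comb, sum_inner, real_inner_smul_left]

theorem le_model (B : Bundle n) (f : Vec n → ℝ) {j m : ℕ} (hj : j ≤ m) (z : Vec n) :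
    f (B.pt j) + inner ℝ (B.g j) (z - B.pt j) ≤ B.model f m z :=
  Finset.le_sup' (fun j : Fin (m + 1) => f (B.pt j) + inner ℝ (B.g j) (z - B.pt j))
    (Finset.mem_univ (⟨j, Nat.lt_succ_of_le hj⟩ : Fin (m + 1)))

theorem model_le {z : Vec n} {c : ℝ}
    (h : ∀ j ≤ m, f (B.pt j) + inner ℝ (B.g j) (z - B.pt j) ≤ c) : B.model f m z ≤ c :=
  Finset.sup'_le _ _ fun j _ => h j (Nat.le_of_lt_succ j.2)

/-- Averages of the affine pieces lie below the cutting-plane model. -/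
theorem average_le_model {w : Fin (m + 1) → ℝ} (hw : w ∈ stdSimplex ℝ (Fin (m + 1)))
    (u : Vec n) :
    ∑ j : Fin (m + 1), (f (B.pt j) + inner ℝ (B.g j) (x - B.pt j)) * w j
      + inner ℝ (B.comb m w) u ≤ B.model f m (x + u) := by
  rw [inner_comb, ← Finset.sum_add_distrib]
  calc _ ≤ ∑ j, w j * B.model f m (x + u) := Finset.sum_le_sum fun j _ => by
        have h := mul_le_mul_of_nonneg_left
          (B.le_model f (Nat.le_of_lt_succ j.2) (x + u)) (hw.1 j)
        have e : x + u - B.pt j = (x - B.pt j) + u := by abel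
        rw [e, inner_add_right] at h
        linarith
    _ = _ := by rw [← Finset.sum_mul, hw.2, one_mul]

theorem nonpos_of_forall_mul_le_sq_mul {a c : ℝ}
    (h : ∀ t : ℝ, 0 < t → t ≤ 1 → t * a ≤ t ^ 2 * c) : a ≤ 0 := by
  by_contra! ha
  have hc : 0 < |c| + 1 := by positivity
  set t := min 1 (a / (2 * (|c| + 1))) with htd
  have ht : 0 < t := lt_min one_pos (by positivity)
  have h1 := h t ht (min_le_left _ _)
  have h2 : t * (2 * (|c| + 1)) ≤ a := by
    rw [← le_div_iff₀ (by positivity)]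
    exact min_le_right _ _
  have h3 : t * a ≤ t * (t * c) := by linarith [h1, (by ring : t ^ 2 * c = t * (t * c))]
  have h4 := le_of_mul_le_mul_left h3 ht
  have h5 : t * c ≤ t * |c| := mul_le_mul_of_nonneg_left (le_abs_self c) ht.le
  nlinarith [mul_nonneg ht.le (abs_nonneg c)]

/-- First-order optimality condition of the dual subproblem. -/
theorem dual_stationary (hN : ∀ z, N z = 0 → z = 0) (hW : W.PosDef) (hδ : 0 ≤ δ)
    {ω w : Fin (m + 1) → ℝ} {γ c : Vec n}
    (hω : ω ∈ stdSimplex ℝ (Fin (m + 1))) (hw : w ∈ stdSimplex ℝ (Fin (m + 1)))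
    (hmax : IsMaxOn (B.dualObj f N x W δ m) (stdSimplex ℝ (Fin (m + 1)) ×ˢ Set.univ) (ω, γ)) :
    inner ℝ (B.comb m w + c) (-act W (B.comb m ω + γ))
        + ∑ j : Fin (m + 1), (f (B.pt j) + inner ℝ (B.g j) (x - B.pt j)) * w j
        - δ * dualNorm N c
      ≤ inner ℝ (B.comb m ω + γ) (-act W (B.comb m ω + γ))
        + ∑ j : Fin (m + 1), (f (B.pt j) + inner ℝ (B.g j) (x - B.pt j)) * ω j
        - δ * dualNorm N γ := by
  set d := B.comb m ω + γ with hd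
  set e := B.comb m w + c with he
  rw [← sub_nonpos]
  -- Move from `(ω, γ)` a fraction `t` towards `(w, c)`: only the quadratic form contributes a `t ^
  -- 2` term, and convexity of the dual norm handles the penalty.
  refine nonpos_of_forall_mul_le_sq_mul
    (c := (1 / 2) * inner ℝ (e - d) (act W (e - d))) fun t ht ht1 => ?_
  have hmem : ((1 - t) • ω + t • w, (1 - t) • γ + t • c) ∈
      stdSimplex ℝ (Fin (m + 1)) ×ˢ (Set.univ : Set (Vec n)) :=
    ⟨convex_stdSimplex ℝ _ hω hw (sub_nonneg.2 ht1) ht.le (by ring), Set.mem_univ _⟩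
  have h : B.dualObj f N x W δ m ((1 - t) • ω + t • w, (1 - t) • γ + t • c) ≤
    B.dualObj f N x W δ m (ω, γ) := hmax hmem
  have hdir : B.comb m ((1 - t) • ω + t • w) + ((1 - t) • γ + t • c) = d + t • (e - d) := by
    rw [comb_combo, hd, he]
    module
  have hsum : ∑ j : Fin (m + 1), (f (B.pt j) + inner ℝ (B.g j) (x - B.pt j)) *
        ((1 - t) • ω + t • w) j
      = (1 - t) * ∑ j : Fin (m + 1), (f (B.pt j) + inner ℝ (B.g j) (x - B.pt j)) * ω j
        + t * ∑ j : Fin (m + 1), (f (B.pt j) + inner ℝ (B.g j) (x - B.pt j)) * w j := by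
    rw [Finset.mul_sum, Finset.mul_sum, ← Finset.sum_add_distrib]
    refine Finset.sum_congr rfl fun j _ => ?_
    simp only [Pi.add_apply, Pi.smul_apply, smul_eq_mul]
    ring
  have hdual := mul_le_mul_of_nonneg_left
    (dualNorm_combo_le hN γ c (sub_nonneg.2 ht1) ht.le) hδ
  simp only [dualObj, hdir, hsum, ← hd] at h
  have e1 := inner_act_comm hW.isHermitian (e - d) d
  have e2 : inner ℝ (e - d) (act W d) = inner ℝ e (act W d) - inner ℝ d (act W d) :=
    inner_sub_left _ _ _
  generalize hq : inner ℝ (e - d) (act W (e - d)) = q at *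
  simp only [act_add, act_smul, inner_add_left, inner_add_right, real_inner_smul_left,
    real_inner_smul_right, hq, ← e1, e2] at h
  simp only [inner_neg_right]
  linarith

/-! ### Consequences of dual optimality; finiteness of the inner loop -/

namespace IsStepRun

/-- Only `γ` is varied: it maximizes `cᵀ s - δ ‖c‖_*`, from which the trust region bound and
complementarity follow. -/
theorem inner_sub_le (hB : B.IsStepRun f N α x W δ) (hN : ∀ z, N z = 0 → z = 0)
    (hW : W.PosDef) (hδ : 0 < δ) (hm : B.Enters f α x m) (c : Vec n) :
    inner ℝ c (-act W (B.dir m)) - δ * dualNorm N c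
      ≤ inner ℝ (B.γ m) (-act W (B.dir m)) - δ * dualNorm N (B.γ m) := by
  have h := dual_stationary hN hW hδ.le (hB.weights m hm) (hB.weights m hm) (c := c)
    (hB.dual m hm)
  simp only [inner_add_left] at h
  simp only [dir]
  linarith

/-- The function maximized by `γ` is positively homogeneous, so its maximum is `0`; the competitors
are `0` and `2γ`. -/
theorem inner_γ_step (hB : B.IsStepRun f N α x W δ) (hN : ∀ z, N z = 0 → z = 0)
    (hW : W.PosDef) (hδ : 0 < δ) (hm : B.Enters f α x m) :
    inner ℝ (B.γ m) (-act W (B.dir m)) = δ * dualNorm N (B.γ m) := by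
  have h0 := hB.inner_sub_le hN hW hδ hm 0
  have h2 := hB.inner_sub_le hN hW hδ hm ((1 : ℝ) • B.γ m + (1 : ℝ) • B.γ m)
  have h3 := mul_le_mul_of_nonneg_left
    (dualNorm_combo_le hN (B.γ m) (B.γ m) zero_le_one zero_le_one) hδ.le
  have hz : dualNorm N (0 : Vec n) = 0 :=
    (dualNorm_le fun t _ => by simp).antisymm (dualNorm_nonneg hN 0)
  rw [hz, inner_zero_left] at h0
  rw [inner_add_left, real_inner_smul_left] at h2
  linarith

/-- The step satisfies the trust region constraint. -/
theorem seminorm_step_le (hB : B.IsStepRun f N α x W δ) (hN : ∀ z, N z = 0 → z = 0)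
    (hW : W.PosDef) (hδ : 0 < δ) (hm : B.Enters f α x m) : N (-act W (B.dir m)) ≤ δ := by
  obtain ⟨c, hc, hcs⟩ := exists_dualNorm_le_one N (-act W (B.dir m))
  have h := hB.inner_sub_le hN hW hδ hm c
  rw [hB.inner_γ_step hN hW hδ hm, hcs] at h
  linarith [mul_le_of_le_one_right hδ.le hc]

/-- Complementary slackness: `δ ‖γ‖_* = γᵀ s ≤ ‖γ‖_* N(s)`, which is impossible for `γ ≠ 0` when
`N(s) < δ`. -/
theorem γ_eq_zero (hB : B.IsStepRun f N α x W δ) (hN : ∀ z, N z = 0 → z = 0)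
    (hW : W.PosDef) (hδ : 0 < δ) (hm : B.Enters f α x m) (hs : N (-act W (B.dir m)) < δ) :
    B.γ m = 0 := by
  have h := inner_le_dualNorm_mul hN (B.γ m) (-act W (B.dir m))
  rw [hB.inner_γ_step hN hW hδ hm] at h
  refine eq_zero_of_dualNorm_eq_zero hN (le_antisymm ?_ (dualNorm_nonneg hN _))
  by_contra! hpos
  linarith [mul_lt_mul_of_pos_left hs hpos]

theorem enters_of_le (hm : B.Enters f α x m) {j : ℕ} (hj : j ≤ m) : B.Enters f α x j :=
  fun i hi => hm i (hi.trans_le hj)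

theorem subgradient_mem (hB : B.IsStepRun f N α x W δ) (hm : B.Enters f α x m) {j : ℕ}
    (hj : j ≤ m) : B.g j ∈ subdiff f (B.pt j) := by
  cases j with
  | zero => exact hB.g_zero
  | succ i => exact hB.g_succ i (enters_of_le hm (Nat.le_of_succ_le hj))

theorem model_le_self (hB : B.IsStepRun f N α x W δ) (hf : ConvexOn ℝ Set.univ f)
    (hm : B.Enters f α x m) (z : Vec n) : B.model f m z ≤ f z :=
  model_le fun _ hj => subgradient_le hf (hB.subgradient_mem hm hj) z

theorem pt_succ_eq (hB : B.IsStepRun f N α x W δ) (hm : B.Enters f α x m) :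
    B.pt (m + 1) = x + -act W (B.dir m) := by
  rw [hB.pt_succ m hm, sub_eq_add_neg]

/-- The aggregate subgradient `G ω` is a subgradient of the model at the trial point. -/
theorem model_add_inner_comb_le (hB : B.IsStepRun f N α x W δ) (hN : ∀ z, N z = 0 → z = 0)
    (hW : W.PosDef) (hδ : 0 < δ) (hm : B.Enters f α x m) (u : Vec n) :
    B.model f m (B.pt (m + 1)) + inner ℝ (B.comb m (B.ω m)) (u - -act W (B.dir m))
      ≤ B.model f m (x + u) := by
  have h1 := average_le_model (B := B) (f := f) (x := x) (hB.weights m hm) u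
  have h2 : B.model f m (B.pt (m + 1)) ≤
      ∑ j : Fin (m + 1), (f (B.pt j) + inner ℝ (B.g j) (x - B.pt j)) * B.ω m j
        + inner ℝ (B.comb m (B.ω m)) (-act W (B.dir m)) := by
    -- Shifting weight to the vertex `j` with `γ` fixed shows that no cut exceeds the `ω`-average at
    -- the trial point.
    refine model_le fun j hj => ?_
    let i : Fin (m + 1) := ⟨j, Nat.lt_succ_of_le hj⟩
    have h := dual_stationary hN hW hδ.le (hB.weights m hm) (single_mem_stdSimplex ℝ i)
      (c := B.γ m) (hB.dual m hm)
    have hc : B.comb m (Pi.single i 1) = B.g j := by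
      simp [comb, Pi.single_apply, ite_smul, i]
    have hs : ∑ l : Fin (m + 1), (f (B.pt l) + inner ℝ (B.g l) (x - B.pt l)) *
        (Pi.single i (1 : ℝ) : Fin (m + 1) → ℝ) l
        = f (B.pt j) + inner ℝ (B.g j) (x - B.pt j) := by
      simp [Pi.single_apply, i]
    rw [hc, hs, inner_add_left, inner_add_left] at h
    have e : B.pt (m + 1) - B.pt j = (x - B.pt j) + -act W (B.dir m) := by
      rw [hB.pt_succ_eq hm]
      abel
    rw [e, inner_add_right]
    simp only [dir] at h ⊢
    linarith
  rw [inner_sub_right]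
  linarith

/-- The model at a point of the trust region, compared with its value at the trial point. -/
theorem model_add_inner_dir_le (hB : B.IsStepRun f N α x W δ) (hN : ∀ z, N z = 0 → z = 0)
    (hW : W.PosDef) (hδ : 0 < δ) (hm : B.Enters f α x m) {u : Vec n} (hu : N u ≤ δ) :
    B.model f m (B.pt (m + 1)) + inner ℝ (B.dir m) u + inner ℝ (B.dir m) (act W (B.dir m))
      ≤ B.model f m (x + u) := by
  have h := hB.model_add_inner_comb_le hN hW hδ hm u
  have h1 := inner_le_dualNorm_mul hN (B.γ m) u
  have h2 := mul_le_mul_of_nonneg_left hu (dualNorm_nonneg hN (B.γ m))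
  have h3 := hB.inner_γ_step hN hW hδ hm
  have e : B.comb m (B.ω m) = B.dir m - B.γ m := by simp [dir]
  rw [e] at h
  simp only [inner_sub_left, inner_sub_right, inner_neg_right] at h h3
  linarith

theorem inner_dir_le (hB : B.IsStepRun f N α x W δ) (hf : ConvexOn ℝ Set.univ f)
    (hN : ∀ z, N z = 0 → z = 0) (hW : W.PosDef) (hδ : 0 < δ) (hm : B.Enters f α x m) :
    inner ℝ (B.dir m) (act W (B.dir m)) ≤ f x - B.model f m (B.pt (m + 1)) := by
  have h := hB.model_add_inner_dir_le hN hW hδ hm (u := 0) (by simpa using hδ.le)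
  have h1 := hB.model_le_self hf hm x
  simp only [inner_zero_right, add_zero] at h
  linarith

/-- At a point that is not a minimizer, the predicted decrease is bounded away from zero. -/
theorem exists_pos_le_decrease (hB : B.IsStepRun f N α x W δ) (hf : ConvexOn ℝ Set.univ f)
    (hN : ∀ z, N z = 0 → z = 0) (hW : W.PosDef) (hδ : 0 < δ) (hx : ¬ IsMinOn f Set.univ x) :
    ∃ c, 0 < c ∧ ∀ m, B.Enters f α x m → c ≤ f x - B.model f m (B.pt (m + 1)) := by
  obtain ⟨z, hz⟩ : ∃ z, f z < f x := by
    by_contra! h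
    exact hx fun z _ => h z
  set w := z - x with hw
  set K := inner ℝ w (act W⁻¹ w) / 4 with hK
  have hK0 : 0 ≤ K := div_nonneg (inner_act_nonneg hW.inv w) (by norm_num)
  have hNw : 0 ≤ N w := apply_nonneg N w
  have hΔ : 0 < f x - f z := sub_pos.2 hz
  -- The second bound keeps `t • w` in the trust region; the third makes the quadratic loss `t² K`
  -- at most half the gain `t (f x - f z)` given by convexity.
  set t := min 1 (min (δ / (N w + 1)) ((f x - f z) / (2 * (K + 1)))) with htd
  have ht : 0 < t := lt_min one_pos (lt_min (by positivity) (by positivity))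
  have ht1 : t ≤ 1 := min_le_left _ _
  have ht2 : t * (N w + 1) ≤ δ := by
    rw [← le_div_iff₀ (by positivity)]
    exact (min_le_right _ _).trans (min_le_left _ _)
  have ht3 : t * (2 * (K + 1)) ≤ f x - f z := by
    rw [← le_div_iff₀ (by positivity)]
    exact (min_le_right _ _).trans (min_le_right _ _)
  refine ⟨t * ((f x - f z) / 2), by positivity, fun m hm => ?_⟩
  have hNt : N (t • w) ≤ δ := by
    rw [map_smul_eq_mul, Real.norm_of_nonneg ht.le]
    linarith
  have h1 := hB.model_add_inner_dir_le hN hW hδ hm hNt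
  have h2 := hB.model_le_self hf hm (x + t • w)
  have h3 := neg_inner_inv_le hW (B.dir m) (t • w)
  have h4 := slope_le_of_convexOn hf x w ht ht1
  rw [div_le_iff₀ ht, hw, add_sub_cancel, ← hw] at h4
  rw [act_smul, real_inner_smul_left, real_inner_smul_right] at h3
  have h5 : t * (t * (2 * (K + 1))) ≤ t * (f x - f z) := mul_le_mul_of_nonneg_left ht3 ht.le
  have h6 : 0 < t * t := mul_pos ht ht
  have h7 : t * (t * inner ℝ w (act W⁻¹ w)) / 4 = t * t * K := by rw [hK]; ring
  linarith

/-- At a point that is not a minimizer, the step procedure returns a step. -/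
theorem returns (hB : B.IsStepRun f N α x W δ) (hf : ConvexOn ℝ Set.univ f)
    (hN : ∀ z, N z = 0 → z = 0) (hW : W.PosDef) (hδ : 0 < δ) (hα : α < 1)
    (hx : ¬ IsMinOn f Set.univ x) : B.Returns f α x := by
  by_contra hret
  obtain ⟨c, hc, hdec⟩ := hB.exists_pos_le_decrease hf hN hW hδ hx
  have hnext : ∀ m, B.Enters f α x m → ¬ B.Stops f x m ∧ ¬ B.Descends f α x m := by
    intro m hm
    have hns : ¬ B.Stops f x m := fun hs => by
      have h1 := hdec m hm
      have h2 : B.model f m (B.pt (m + 1)) = f x := hs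
      linarith
    exact ⟨hns, fun hd => hret ⟨m, hm, hns, hd⟩⟩
  have hall : ∀ m, B.Enters f α x m := by
    intro m
    induction m with
    | zero => exact fun i hi => absurd hi (Nat.not_lt_zero i)
    | succ m ih =>
      intro i hi
      exact hnext i (enters_of_le ih (Nat.le_of_lt_succ hi))
  obtain ⟨C, hC, hCN⟩ := exists_norm_le_mul_seminorm hN
  have hpt : ∀ m, ‖B.pt m‖ ≤ ‖x‖ + C * δ := by
    intro m
    cases m with
    | zero =>
      rw [hB.pt_zero]
      linarith [mul_pos hC hδ]
    | succ m =>
      rw [hB.pt_succ_eq (hall m)]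
      exact (norm_add_le _ _).trans (add_le_add_right ((hCN _).trans
        (mul_le_mul_of_nonneg_left (hB.seminorm_step_le hN hW hδ (hall m)) hC.le)) _)
  obtain ⟨L, hL0, hL⟩ := exists_norm_subgradient_le hf (‖x‖ + C * δ)
  have hg : ∀ m, B.g m ∈ subdiff f (B.pt m) := fun m => hB.subgradient_mem (hall m) le_rfl
  obtain ⟨a, -, φ, hφ, hlim⟩ := tendsto_subseq_of_bounded
    (Metric.isBounded_closedBall (x := (0 : Vec n)) (r := ‖x‖ + C * δ)) (x := B.pt)
    (fun m => by simpa using hpt m)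
  -- Two cuts at distance `r` give `f - model ≤ 2 L r` at the later point, whereas a failed descent
  -- test gives `f - model > (1 - α) c`.
  have hε : 0 < (1 - α) * c / (2 * L + 1) :=
    div_pos (mul_pos (sub_pos.2 hα) hc) (by positivity)
  obtain ⟨i₀, hi₀⟩ := Metric.cauchySeq_iff.1 hlim.cauchySeq _ hε
  have hdist := hi₀ (i₀ + 1) (Nat.le_succ _) i₀ le_rfl
  set j := φ i₀
  -- The later index is positive, so it belongs to a trial point whose model already contains the
  -- cut at `j`.
  obtain ⟨m, hm⟩ : ∃ m, φ (i₀ + 1) = m + 1 :=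
    Nat.exists_eq_succ_of_ne_zero (Nat.ne_of_gt (Nat.zero_lt_of_lt (hφ (Nat.lt_succ_self i₀))))
  have hjm : j ≤ m := Nat.le_of_lt_succ ((hφ (Nat.lt_succ_self i₀)).trans_eq hm)
  simp only [Function.comp_apply, hm] at hdist
  rw [dist_eq_norm, lt_div_iff₀ (by positivity)] at hdist
  have h1 := B.le_model f hjm (B.pt (m + 1))
  have h2 := subgradient_le hf (hg (m + 1)) (B.pt j)
  have hL' : ∀ l (u : Vec n), |(inner ℝ (B.g l) u : ℝ)| ≤ L * ‖u‖ := fun l u =>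
    (abs_real_inner_le_norm _ _).trans
      (mul_le_mul_of_nonneg_right (hL _ _ (hpt l) (hg l)) (norm_nonneg _))
  have h3 := (abs_le.1 (hL' j (B.pt (m + 1) - B.pt j))).1
  have h4 := (abs_le.1 (hL' (m + 1) (B.pt j - B.pt (m + 1)))).1
  rw [norm_sub_rev] at h4
  have h5 : f x - f (B.pt (m + 1)) < α * (f x - B.model f m (B.pt (m + 1))) :=
    not_le.1 (hnext m (hall m)).2
  have h6 := mul_le_mul_of_nonneg_left (hdec m (hall m)) (sub_nonneg.2 hα.le)
  linarith [norm_nonneg (B.pt (m + 1) - B.pt j)]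

end IsStepRun
end Bundle

/-! ### The matrix update -/

theorem act_sub_smul_vecMulVec (ρ : ℝ) (a b u : Vec n) :
    act (1 - ρ • Matrix.vecMulVec a.ofLp b.ofLp) u = u - (ρ * inner ℝ b u) • a := by
  ext i
  simp [act, Matrix.sub_mulVec, Matrix.smul_mulVec, Matrix.vecMulVec_mulVec,
    inner_eq_dotProduct]
  ring

theorem act_smul_vecMulVec (ρ : ℝ) (a b u : Vec n) :
    act (ρ • Matrix.vecMulVec a.ofLp b.ofLp) u = (ρ * inner ℝ b u) • a := by
  ext i
  simp [act, Matrix.smul_mulVec, Matrix.vecMulVec_mulVec, inner_eq_dotProduct]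
  ring

theorem act_add_matrix (A C : Matrix (Fin n) (Fin n) ℝ) (u : Vec n) :
    act (A + C) u = act A u + act C u := by
  ext i; simp [act, Matrix.add_mulVec]

theorem act_sub_matrix (A C : Matrix (Fin n) (Fin n) ℝ) (u : Vec n) :
    act (A - C) u = act A u - act C u := by
  ext i; simp [act, Matrix.sub_mulVec]

theorem act_injective : Function.Injective (act : Matrix (Fin n) (Fin n) ℝ → Vec n → Vec n) := by
  intro A C h
  refine Matrix.mulVec_injective (funext fun u => ?_)
  exact congrArg WithLp.ofLp (congrFun h (WithLp.toLp 2 u))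

theorem act_updateW (W : Matrix (Fin n) (Fin n) ℝ) (s v u : Vec n) :
    act (updateW W s v) u =
      act W (u - ((inner ℝ s v)⁻¹ * inner ℝ s u) • v)
        - ((inner ℝ s v)⁻¹ * inner ℝ v (act W (u - ((inner ℝ s v)⁻¹ * inner ℝ s u) • v))) • s
        + ((inner ℝ s v)⁻¹ * inner ℝ s u) • s := by
  rw [updateW, act_add_matrix, act_mul, act_mul, act_smul_vecMulVec, Matrix.transpose_sub,
    Matrix.transpose_one, Matrix.transpose_smul, Matrix.transpose_vecMulVec,
    act_sub_smul_vecMulVec, act_sub_smul_vecMulVec]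

/-- With `p = u - ρ (sᵀu) v` the new form is `pᵀ W p + ρ (sᵀu)²`; if `sᵀu = 0`, then `p = u`. -/
theorem updateW_posDef {W : Matrix (Fin n) (Fin n) ℝ} (hW : W.PosDef) {s v : Vec n}
    (hsv : 0 < inner ℝ s v) : (updateW W s v).PosDef := by
  refine posDef_of_inner_act_pos ?_ fun u hu => ?_
  · have h1 := Matrix.isHermitian_conjTranspose_mul_mul
      (1 - (inner ℝ s v : ℝ)⁻¹ • Matrix.vecMulVec v.ofLp s.ofLp) hW.isHermitian
    rw [Matrix.conjTranspose_eq_transpose_of_trivial] at h1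
    refine h1.add ?_
    rw [Matrix.IsHermitian, Matrix.conjTranspose_eq_transpose_of_trivial,
      Matrix.transpose_smul, Matrix.transpose_vecMulVec]
  · set ρ := (inner ℝ s v : ℝ)⁻¹ with hρ
    have hρ0 : 0 < ρ := inv_pos.2 hsv
    set p := u - (ρ * inner ℝ s u) • v with hp
    have e : inner ℝ u (act (updateW W s v) u)
        = inner ℝ p (act W p) + ρ * (inner ℝ s u) ^ 2 := by
      rw [act_updateW, ← hρ, ← hp]
      have h2 : inner ℝ p (act W p)
          = inner ℝ u (act W p) - ρ * inner ℝ s u * inner ℝ v (act W p) := by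
        conv_lhs => rw [hp]
        rw [← hp, inner_sub_left, real_inner_smul_left]
      rw [h2, inner_add_right, inner_sub_right, real_inner_smul_right, real_inner_smul_right,
        real_inner_comm s u]
      ring
    rw [e]
    rcases eq_or_ne (inner ℝ s u : ℝ) 0 with h0 | h0
    · have : p = u := by simp [hp, h0]
      rw [this, h0]
      simpa using inner_act_pos hW hu
    · have := inner_act_nonneg hW p
      positivity

/-- Sylvester's identity reduces the determinant to a `2 × 2` one. -/
theorem det_one_add_vecMulVec_add_vecMulVec (a b c e : Fin n → ℝ) :
    (1 + Matrix.vecMulVec a b + Matrix.vecMulVec c e).det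
      = (1 + b ⬝ᵥ a) * (1 + e ⬝ᵥ c) - (b ⬝ᵥ c) * (e ⬝ᵥ a) := by
  have h : (1 + Matrix.vecMulVec a b + Matrix.vecMulVec c e : Matrix (Fin n) (Fin n) ℝ)
      = 1 + (Matrix.of fun i => ![a i, c i]) * (Matrix.of ![b, e] : Matrix (Fin 2) (Fin n) ℝ) := by
    ext i j
    simp [Matrix.mul_apply, Fin.sum_univ_two, Matrix.vecMulVec_apply, add_assoc]
  rw [h, Matrix.det_one_add_mul_comm, Matrix.det_fin_two]
  simp [Matrix.vecMul, dotProduct]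

/-! ### Inverse, trace and determinant after an update, and the potential -/

section Update

variable {W : Matrix (Fin n) (Fin n) ℝ} {s v d : Vec n}

/-- The inverse of the updated matrix, where `s = -W d`. -/
theorem inv_updateW (hW : W.PosDef) (hs : s = -act W d) (hd : d ≠ 0) (hsv : 0 < inner ℝ s v) :
    (updateW W s v)⁻¹ = W⁻¹
      - (inner ℝ d (act W d) : ℝ)⁻¹ • Matrix.vecMulVec d.ofLp d.ofLp
      + (inner ℝ s v : ℝ)⁻¹ • Matrix.vecMulVec v.ofLp v.ofLp := by
  have hdet : IsUnit W.det := hW.det_pos.ne'.isUnit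
  refine Matrix.inv_eq_right_inv (act_injective (funext fun u => ?_))
  have hD := (inner_act_pos hW hd).ne'
  have hWi : act W (act W⁻¹ u) = u := by
    rw [← act_mul, Matrix.mul_nonsing_inv _ hdet, act_one]
  have hWd : act W d = -s := by rw [hs, neg_neg]
  rw [act_one, act_mul, act_add_matrix, act_sub_matrix, act_smul_vecMulVec, act_smul_vecMulVec]
  have h1 : inner ℝ s (act W⁻¹ u) = -inner ℝ d u := by
    rw [hs, inner_neg_left, real_inner_comm, inner_act_comm hW.isHermitian, hWi]
  have h2 : inner ℝ s d = -inner ℝ d (act W d) := by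
    rw [hWd, inner_neg_right, neg_neg, real_inner_comm]
  set D : ℝ := inner ℝ d (act W d) with hDdef
  set ρ : ℝ := (inner ℝ s v)⁻¹ with hρ
  have hρs : ρ * inner ℝ s v = 1 := inv_mul_cancel₀ hsv.ne'
  -- Secant equation: the candidate inverse is symmetric and sends `s` to `v`, so the projection in
  -- the update cancels its `v` term.
  have h3 : inner ℝ s (act W⁻¹ u - (D⁻¹ * inner ℝ d u) • d + (ρ * inner ℝ v u) • v)
      = inner ℝ v u := by
    rw [inner_add_right, inner_sub_right, real_inner_smul_right, real_inner_smul_right, h1, h2]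
    have : D⁻¹ * inner ℝ d u * -D = -inner ℝ d u := by field_simp
    rw [this]
    linear_combination inner ℝ v u * hρs
  rw [act_updateW, ← hρ, h3, add_sub_cancel_right]
  have h4 : act W (act W⁻¹ u - (D⁻¹ * inner ℝ d u) • d) = u + (D⁻¹ * inner ℝ d u) • s := by
    rw [sub_eq_add_neg, ← neg_smul, act_add, act_smul, hWi, hWd]
    module
  rw [h4, inner_add_right, real_inner_smul_right, real_inner_comm s v]
  have h5 : ρ * (inner ℝ v u + D⁻¹ * inner ℝ d u * inner ℝ s v)
      = ρ * inner ℝ v u + D⁻¹ * inner ℝ d u := by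
    linear_combination (D⁻¹ * inner ℝ d u) * hρs
  rw [h5]
  module

theorem trace_inv_updateW (hW : W.PosDef) (hs : s = -act W d) (hd : d ≠ 0)
    (hsv : 0 < inner ℝ s v) :
    (updateW W s v)⁻¹.trace
      = W⁻¹.trace - ‖d‖ ^ 2 / inner ℝ d (act W d) + ‖v‖ ^ 2 / inner ℝ s v := by
  rw [inv_updateW hW hs hd hsv, Matrix.trace_add, Matrix.trace_sub, Matrix.trace_smul,
    Matrix.trace_smul, Matrix.trace_vecMulVec, Matrix.trace_vecMulVec, ← inner_eq_dotProduct,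
    ← inner_eq_dotProduct, real_inner_self_eq_norm_sq, real_inner_self_eq_norm_sq]
  simp only [smul_eq_mul]
  ring

theorem det_inv_updateW (hW : W.PosDef) (hs : s = -act W d) (hd : d ≠ 0)
    (hsv : 0 < inner ℝ s v) :
    (updateW W s v)⁻¹.det = W⁻¹.det * (inner ℝ s v / inner ℝ d (act W d)) := by
  have hdet : IsUnit W.det := hW.det_pos.ne'.isUnit
  have hD := (inner_act_pos hW hd).ne'
  have hWd : act W d = -s := by rw [hs, neg_neg]
  set D : ℝ := inner ℝ d (act W d) with hDdef
  set ρ : ℝ := (inner ℝ s v)⁻¹ with hρ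
  have hρs : ρ * inner ℝ s v = 1 := inv_mul_cancel₀ hsv.ne'
  have hfac : (updateW W s v)⁻¹ = W⁻¹ * (1
      + Matrix.vecMulVec (D⁻¹ • s).ofLp d.ofLp + Matrix.vecMulVec (ρ • act W v).ofLp v.ofLp) := by
    rw [inv_updateW hW hs hd hsv]
    refine act_injective (funext fun u => ?_)
    have h1 := act_smul_vecMulVec 1 (D⁻¹ • s) d u
    have h2 := act_smul_vecMulVec 1 (ρ • act W v) v u
    have hi : ∀ w, act W⁻¹ (act W w) = w := fun w => by
      rw [← act_mul, Matrix.nonsing_inv_mul _ hdet, act_one]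
    have his : act W⁻¹ s = -d := by
      rw [hs, ← neg_one_smul ℝ (act W d), act_smul, hi, neg_one_smul]
    rw [one_smul, one_mul] at h1 h2
    rw [act_mul, act_add_matrix, act_add_matrix, act_sub_matrix, act_add_matrix, act_one, h1, h2,
      act_smul_vecMulVec, act_smul_vecMulVec, act_add, act_add, act_smul, act_smul, act_smul,
      act_smul, hi, his]
    module
  rw [hfac, Matrix.det_mul, det_one_add_vecMulVec_add_vecMulVec]
  simp only [← inner_eq_dotProduct, real_inner_smul_right]
  have h1 : inner ℝ d s = -D := by rw [hDdef, hWd, inner_neg_right, neg_neg]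
  have h2 : inner ℝ d (act W v) = -inner ℝ s v := by
    rw [inner_act_comm hW.isHermitian, hWd, inner_neg_right, real_inner_comm]
  rw [h1, h2, real_inner_comm s v]
  have h3 : D⁻¹ * -D = -1 := by field_simp
  rw [h3]
  linear_combination (W⁻¹.det * (D⁻¹ * inner ℝ s v)) * hρs

end Update

/-- The potential `tr W⁻¹ - log det W⁻¹` of a positive definite matrix. -/
noncomputable def potential (W : Matrix (Fin n) (Fin n) ℝ) : ℝ := W⁻¹.trace - Real.log W⁻¹.det

/-- Each eigenvalue `λ` of `W⁻¹` contributes `λ - log λ ≥ 1`. -/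
theorem potential_nonneg {W : Matrix (Fin n) (Fin n) ℝ} (hW : W.PosDef) : 0 ≤ potential W := by
  have hH := hW.inv
  rw [potential, hH.isHermitian.trace_eq_sum_eigenvalues,
    hH.isHermitian.det_eq_prod_eigenvalues]
  simp only [RCLike.ofReal_real_eq_id, id_eq]
  rw [Real.log_prod fun i _ => (hH.eigenvalues_pos i).ne', ← Finset.sum_sub_distrib]
  refine Finset.sum_nonneg fun i _ => ?_
  have := Real.log_le_sub_one_of_pos (hH.eigenvalues_pos i)
  linarith

theorem Bounds.inner_pos {η θ : ℝ} {s v : Vec n} (h : Bounds η θ s v) (hη : 0 < η) :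
    s ≠ 0 ∧ 0 < inner ℝ s v := by
  have h0 : 0 < inner ℝ s v / ‖s‖ ^ 2 := hη.trans_le h.1
  have hs : s ≠ 0 := by
    rintro rfl
    simp at h0
  exact ⟨hs, by
    have := mul_pos h0 (pow_pos (norm_pos_iff.2 hs) 2)
    rwa [div_mul_cancel₀ _ (pow_pos (norm_pos_iff.2 hs) 2).ne'] at this⟩

/-- The bound `θ` limits the growth of the trace, and `η` bounds the determinant ratio `sᵀv / D`
below by `η ‖s‖² / D`. -/
theorem potential_updateW_le {W : Matrix (Fin n) (Fin n) ℝ} {s v d : Vec n} {η θ : ℝ}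
    (hW : W.PosDef) (hs : s = -act W d) (hη : 0 < η) (hb : Bounds η θ s v) :
    potential (updateW W s v) ≤ potential W + (θ - Real.log η)
      - ‖d‖ ^ 2 / inner ℝ d (act W d) + Real.log (inner ℝ d (act W d) / ‖s‖ ^ 2) := by
  obtain ⟨hs0, hsv⟩ := hb.inner_pos hη
  have hd : d ≠ 0 := by
    rintro rfl
    exact hs0 (by rw [hs]; ext i; simp [act])
  have hD := inner_act_pos hW hd
  have hn : 0 < ‖s‖ ^ 2 := pow_pos (norm_pos_iff.2 hs0) 2
  rw [potential, potential, trace_inv_updateW hW hs hd hsv, det_inv_updateW hW hs hd hsv,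
    Real.log_mul hW.inv.det_pos.ne' (div_pos hsv hD).ne', Real.log_div hsv.ne' hD.ne',
    Real.log_div hD.ne' hn.ne']
  have h1 := Real.log_le_log hη hb.1
  rw [Real.log_div hsv.ne' hn.ne'] at h1
  linarith [hb.2]

/-- Along infinitely many iterations, the gradient and the step are controlled by the
predicted decrease. -/
theorem exists_frequently_norm_sq_le {W : ℕ → Matrix (Fin n) (Fin n) ℝ} {s v d : ℕ → Vec n}
    {η θ : ℝ} (hW : ∀ k, (W k).PosDef) (hWs : ∀ k, W (k + 1) = updateW (W k) (s k) (v k))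
    (hs : ∀ k, s k = -act (W k) (d k)) (hη : 0 < η) (hb : ∀ k, Bounds η θ (s k) (v k)) :
    ∃ C, ∃ᶠ k in atTop, ‖d k‖ ^ 2 ≤ C * inner ℝ (d k) (act (W k) (d k)) ∧
      ‖s k‖ ^ 2 ≤ C * inner ℝ (d k) (act (W k) (d k)) := by
  set M := θ - Real.log η + 1 with hM
  -- A potential drop of less than `1` forces `r - log q ≤ M` for `r = ‖d‖² / D`, `q = D / ‖s‖²`.
  -- Cauchy–Schwarz gives `q ≤ r`, so `log q ≤ r / 2`; hence `r ≤ 2 M` and `q ≥ exp (-M)`.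
  refine ⟨max (2 * M) (Real.exp M), fun hev => ?_⟩
  obtain ⟨k₀, hk₀⟩ := eventually_atTop.1 hev
  have hdec : ∀ k ≥ k₀, potential (W (k + 1)) ≤ potential (W k) - 1 := by
    intro k hk
    have hpot := potential_updateW_le (hW k) (hs k) hη (hb k)
    rw [← hWs k] at hpot
    by_contra! hlt
    obtain ⟨hs0, -⟩ := (hb k).inner_pos hη
    have hd : d k ≠ 0 := fun h0 => hs0 (by rw [hs k, h0]; ext i; simp [act])
    have hD := inner_act_pos (hW k) hd
    have hn : 0 < ‖s k‖ ^ 2 := pow_pos (norm_pos_iff.2 hs0) 2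
    have hdn : 0 < ‖d k‖ ^ 2 := pow_pos (norm_pos_iff.2 hd) 2
    have hcs : inner ℝ (d k) (act (W k) (d k)) ≤ ‖d k‖ * ‖s k‖ := by
      rw [hs k, norm_neg]
      exact real_inner_le_norm _ _
    have hbad := hk₀ k hk
    generalize hDe : (inner ℝ (d k) (act (W k) (d k)) : ℝ) = D at *
    set r := ‖d k‖ ^ 2 / D with hr
    set q := D / ‖s k‖ ^ 2 with hq
    have hr0 : 0 < r := div_pos hdn hD
    have hq0 : 0 < q := div_pos hD hn
    have hqr : q ≤ r := by
      rw [hq, hr, div_le_div_iff₀ hn hD, ← mul_pow, ← pow_two]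
      exact pow_le_pow_left₀ hD.le hcs 2
    have h1 : r - M ≤ Real.log q := by linarith
    have h2 : Real.log q ≤ r / 2 := by
      have h3 := Real.log_le_log hq0 hqr
      have h4 := Real.log_le_sub_one_of_pos (half_pos hr0)
      rw [Real.log_div hr0.ne' two_ne_zero] at h4
      have h5 := Real.log_le_sub_one_of_pos (zero_lt_two (α := ℝ))
      linarith
    have h6 : r ≤ 2 * M := by linarith
    have h7 : Real.exp (-M) ≤ q := by
      rw [← Real.le_log_iff_exp_le hq0]
      linarith
    beta_reduce at hbad
    rw [hDe] at hbad
    refine hbad ⟨?_, ?_⟩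
    · rw [hr, div_le_iff₀ hD] at h6
      exact h6.trans (mul_le_mul_of_nonneg_right (le_max_left _ _) hD.le)
    · rw [hq, le_div_iff₀ hn, Real.exp_neg, inv_mul_le_iff₀ (Real.exp_pos M)] at h7
      exact h7.trans (mul_le_mul_of_nonneg_right (le_max_right _ _) hD.le)
  have hlin : ∀ j : ℕ, potential (W (k₀ + j)) ≤ potential (W k₀) - j := by
    intro j
    induction j with
    | zero => simp
    | succ j ih =>
      have := hdec (k₀ + j) (Nat.le_add_right _ _)
      rw [add_assoc] at this
      push_cast
      linarith
  obtain ⟨j, hj⟩ := exists_nat_gt (potential (W k₀))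
  linarith [hlin j, potential_nonneg (hW (k₀ + j))]

/-! ### Convergence of the outer loop -/

namespace Trace.IsRun

variable {T : Trace n} {f : Vec n → ℝ} {P : Params n}

theorem bounds (hT : T.IsRun f P) {k : ℕ} (hk : T.Reached f P (k + 1)) :
    Bounds P.η P.θ (T.s f P k) (T.v f P k (T.β k)) :=
  (hT.β_least k hk).1.2

/-- The claims need a joint induction: the inner loop is finite because `W` is positive definite and
`δ > 0`, and these persist only through completed updates. -/
theorem reached_and_pos (hT : T.IsRun f P) (hf : ConvexOn ℝ Set.univ f) (hP : P.Valid)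
    (hmin : ∀ k, T.Reached f P k → ¬ IsMinOn f Set.univ (T.x k)) (k : ℕ) :
    T.Reached f P k ∧ (T.W k).PosDef ∧ 0 < T.δ k := by
  induction k with
  | zero =>
    exact ⟨fun i hi => absurd hi (Nat.not_lt_zero i), hT.W_zero ▸ hP.W₁_pos,
      hT.δ_zero ▸ hP.δ₁_pos⟩
  | succ k ih =>
    obtain ⟨hk, hW, hδ⟩ := ih
    have hr : T.Reached f P (k + 1) := fun i hi => by
      rcases Nat.lt_succ_iff_lt_or_eq.1 hi with h | rfl
      · exact hk i h
      · exact (hT.step i hk).returns hf hP.norm_def hW hδ hP.α_mem.2 (hmin i hk)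
    refine ⟨hr, ?_, ?_⟩
    · rw [hT.W_succ k hr]
      exact updateW_posDef hW ((hT.bounds hr).inner_pos hP.η_mem.1).2
    · rw [hT.δ_succ k hr]
      split_ifs
      · exact mul_pos hP.τ_mem.1 hδ
      · exact hδ

theorem returnsAt_last {k : ℕ} (hr : (T.B k).Returns f P.α (T.x k)) :
    (T.B k).ReturnsAt f P.α (T.x k) (T.last f P k) :=
  Nat.sInf_mem hr

/-- Convergence of a run that never reaches a minimizer. -/
theorem convergence (hT : T.IsRun f P) (hf : ConvexOn ℝ Set.univ f)
    (hbdd : BddBelow (Set.range f)) (hP : P.Valid)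
    (hmin : ∀ k, T.Reached f P k → ¬ IsMinOn f Set.univ (T.x k)) :
    (∀ k, T.Reached f P k) ∧
      Antitone T.δ ∧ Tendsto T.δ atTop (𝓝 0) ∧
      (T.shrinkSet P).Infinite ∧
      Tendsto (fun k => ‖T.Gω f P k‖) (atTop ⊓ 𝓟 (T.shrinkSet P)) (𝓝 0) ∧
      ∀ z : Vec n, MapClusterPt z (atTop ⊓ 𝓟 (T.shrinkSet P)) T.x → IsMinOn f Set.univ z := by
  have hreach : ∀ k, T.Reached f P k := fun k => (hT.reached_and_pos hf hP hmin k).1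
  have hW : ∀ k, (T.W k).PosDef := fun k => (hT.reached_and_pos hf hP hmin k).2.1
  have hδ : ∀ k, 0 < T.δ k := fun k => (hT.reached_and_pos hf hP hmin k).2.2
  have hN := hP.norm_def
  have hα := hP.α_mem.1
  have hτ := hP.τ_mem
  have hB := fun k => hT.step k (hreach k)
  have hret : ∀ k, (T.B k).ReturnsAt f P.α (T.x k) (T.last f P k) := fun k =>
    returnsAt_last (hreach (k + 1) k (Nat.lt_succ_self k))
  set d : ℕ → Vec n := fun k => (T.B k).dir (T.last f P k) with hd
  set l : ℕ → ℝ := fun k => (T.B k).model f (T.last f P k) (T.x (k + 1)) with hl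
  have hs : ∀ k, T.s f P k = -act (T.W k) (d k) := fun k => rfl
  have hdG : ∀ k, T.Gω f P k + T.γ f P k = d k := fun k => rfl
  have hpt : ∀ k, (T.B k).pt (T.last f P k + 1) = T.x (k + 1) := fun k => by
    rw [(hB k).pt_succ_eq (hret k).1, hT.x_succ k (hreach _)]
    rfl
  have hdesc : ∀ k, P.α * (f (T.x k) - l k) ≤ f (T.x k) - f (T.x (k + 1)) := fun k => by
    have h : f (T.x k) - f ((T.B k).pt (T.last f P k + 1)) ≥ P.α * (f (T.x k) -
      (T.B k).model f (T.last f P k) ((T.B k).pt (T.last f P k + 1))) := (hret k).2.2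
    rwa [hpt] at h
  have hDle : ∀ k, inner ℝ (d k) (act (T.W k) (d k)) ≤ f (T.x k) - l k := fun k => by
    have h := (hB k).inner_dir_le hf hN (hW k) (hδ k) (hret k).1
    rwa [hpt] at h
  have hD0 : ∀ k, 0 ≤ inner ℝ (d k) (act (T.W k) (d k)) := fun k => inner_act_nonneg (hW k) _
  have hanti : Antitone fun k => f (T.x k) := antitone_nat_of_succ_le fun k => by
    have := mul_nonneg hα.le ((hD0 k).trans (hDle k))
    linarith [hdesc k]
  have hlimf : Tendsto (fun k => f (T.x k)) atTop (𝓝 (⨅ k, f (T.x k))) :=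
    tendsto_atTop_ciInf hanti (hbdd.mono (Set.range_comp_subset_range T.x f))
  have hgap : Tendsto (fun k => f (T.x k) - l k) atTop (𝓝 0) := by
    have h : Tendsto (fun k => (f (T.x k) - f (T.x (k + 1))) / P.α) atTop (𝓝 0) := by
      have := (hlimf.sub (hlimf.comp (tendsto_add_atTop_nat 1))).div_const P.α
      rwa [sub_self, zero_div] at this
    refine squeeze_zero (fun k => (hD0 k).trans (hDle k)) (fun k => ?_) h
    rw [le_div_iff₀ hα]
    linarith [hdesc k]
  have hDlim : Tendsto (fun k => inner ℝ (d k) (act (T.W k) (d k))) atTop (𝓝 0) :=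
    squeeze_zero hD0 hDle hgap
  have hδs : ∀ k, T.δ (k + 1) = T.δ k ∨ T.δ (k + 1) = P.τ * T.δ k := fun k => by
    rw [hT.δ_succ k (hreach _)]
    split_ifs
    · exact Or.inr rfl
    · exact Or.inl rfl
  -- Since `δ > 0` and `τ < 1`, the radius equals `τ δ` only if the test succeeded.
  have hmem : ∀ k, k ∈ T.shrinkSet P ↔ max (max (P.υ₁ * ‖d k‖) (P.υ₂ * ‖T.s f P k‖))
      (P.υ₃ * ‖T.Gω f P k‖) ≤ T.δ k := fun k => by
    have h := hT.δ_succ k (hreach _)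
    rw [hdG] at h
    have hlt : P.τ * T.δ k < T.δ k := mul_lt_of_lt_one_left (hδ k) hτ.2
    constructor
    · intro hk
      by_contra hc
      rw [if_neg hc] at h
      have hk' : T.δ (k + 1) = P.τ * T.δ k := hk
      linarith
    · intro hc
      rw [if_pos hc] at h
      exact h
  have hδanti : Antitone T.δ := antitone_nat_of_succ_le fun k => by
    rcases hδs k with h | h
    · exact h.le
    · exact h ▸ (mul_lt_of_lt_one_left (hδ k) hτ.2).le
  obtain ⟨C, hfreq⟩ := exists_frequently_norm_sq_le hW (fun k => hT.W_succ k (hreach _)) hs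
    hP.η_mem.1 (fun k => hT.bounds (hreach _))
  obtain ⟨A, hA⟩ : ∃ A, ∀ u, P.N u ≤ A * ‖u‖ := by
    obtain ⟨A, -, hA⟩ := P.N.bound_of_continuous_normedSpace
      (continuous_of_convexOn_univ P.N.convexOn)
    exact ⟨A, hA⟩
  have hinf : (T.shrinkSet P).Infinite := by
    by_contra hfin
    rw [Set.not_infinite] at hfin
    obtain ⟨k₀, hk₀⟩ := hfin.bddAbove
    have hout : ∀ k, k₀ < k → k ∉ T.shrinkSet P := fun k hk hks => (hk₀ hks).not_gt hk
    have hconst : ∀ k, k₀ + 1 ≤ k → T.δ k = T.δ (k₀ + 1) := by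
      intro k hk
      induction k, hk using Nat.le_induction with
      | base => rfl
      | succ k hk ih => exact ((hδs k).resolve_right (hout k hk)).trans ih
    set δ' := T.δ (k₀ + 1) with hδ'
    have hδ0 : 0 < δ' := hδ _
    -- Used with the three `υ` for the shrinking test, and with `|A|` to place the step strictly
    -- inside the trust region.
    have hsmall : ∀ c : ℝ, 0 ≤ c → ∀ᶠ k in atTop, ∀ u : Vec n,
        ‖u‖ ^ 2 ≤ C * inner ℝ (d k) (act (T.W k) (d k)) → c * ‖u‖ < δ' := by
      intro c hc
      have h : Tendsto (fun k => c * √(C * inner ℝ (d k) (act (T.W k) (d k)))) atTop (𝓝 0) := by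
        have := ((hDlim.const_mul C).sqrt).const_mul c
        simpa using this
      filter_upwards [h.eventually_lt_const hδ0] with k hk u hu
      exact (mul_le_mul_of_nonneg_left (Real.le_sqrt_of_sq_le hu) hc).trans_lt hk
    obtain ⟨k, ⟨hkd, hks⟩, h1, h2, h3, h4, hk⟩ := (hfreq.and_eventually
      ((hsmall P.υ₁ hP.υ₁_pos.le).and ((hsmall P.υ₂ hP.υ₂_pos.le).and
        ((hsmall P.υ₃ hP.υ₃_pos.le).and ((hsmall |A| (abs_nonneg A)).and
          (eventually_ge_atTop (k₀ + 1))))))).exists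
    have hγ : T.γ f P k = 0 := by
      refine (hB k).γ_eq_zero hN (hW k) (hδ k) (hret k).1 ?_
      rw [hconst k hk]
      refine lt_of_le_of_lt ((hA _).trans (mul_le_mul_of_nonneg_right (le_abs_self A)
        (norm_nonneg _))) (h4 (T.s f P k) hks)
    have hG : T.Gω f P k = d k := by rw [← hdG k, hγ, add_zero]
    refine hout k hk ((hmem k).2 ?_)
    rw [hG, hconst k hk]
    exact max_le (max_le (h1 _ hkd).le (h2 _ hks).le) (h3 _ hkd).le
  have hδlim : Tendsto T.δ atTop (𝓝 0) := by
    have hlim := tendsto_atTop_ciInf hδanti ⟨0, by rintro _ ⟨k, rfl⟩; exact (hδ k).le⟩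
    set L := ⨅ k, T.δ k
    -- The relation `δ (k + 1) = τ δ k` holds infinitely often and so passes to the limit.
    have hL : P.τ * L = L := by
      have hfr : ∃ᶠ k in atTop, T.δ (k + 1) - P.τ * T.δ k = 0 :=
        (Nat.frequently_atTop_iff_infinite.2 hinf).mono fun k hk => sub_eq_zero.2 hk
      have ht : Tendsto (fun k => T.δ (k + 1) - P.τ * T.δ k) atTop (𝓝 (L - P.τ * L)) :=
        (hlim.comp (tendsto_add_atTop_nat 1)).sub (hlim.const_mul _)
      have := isClosed_singleton.mem_of_frequently_of_tendsto (s := {(0 : ℝ)}) hfr ht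
      exact (sub_eq_zero.1 this).symm
    have : L = 0 := by
      by_contra h0
      exact hτ.2.ne (mul_right_cancel₀ h0 (hL.trans (one_mul L).symm))
    rwa [this] at hlim
  have hevK : ∀ᶠ k in atTop ⊓ 𝓟 (T.shrinkSet P), k ∈ T.shrinkSet P :=
    mem_inf_of_right (mem_principal_self _)
  have hGlim : Tendsto (fun k => ‖T.Gω f P k‖) (atTop ⊓ 𝓟 (T.shrinkSet P)) (𝓝 0) := by
    have h := (hδlim.div_const P.υ₃).mono_left
      (inf_le_left : atTop ⊓ 𝓟 (T.shrinkSet P) ≤ atTop)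
    rw [zero_div] at h
    refine squeeze_zero' (Eventually.of_forall fun _ => norm_nonneg _) ?_ h
    filter_upwards [hevK] with k hk
    rw [le_div_iff₀ hP.υ₃_pos, mul_comm]
    exact (le_max_right _ _).trans ((hmem k).1 hk)
  have hslim : Tendsto (fun k => ‖T.s f P k‖) (atTop ⊓ 𝓟 (T.shrinkSet P)) (𝓝 0) := by
    have h := (hδlim.div_const P.υ₂).mono_left
      (inf_le_left : atTop ⊓ 𝓟 (T.shrinkSet P) ≤ atTop)
    rw [zero_div] at h
    refine squeeze_zero' (Eventually.of_forall fun _ => norm_nonneg _) ?_ h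
    filter_upwards [hevK] with k hk
    rw [le_div_iff₀ hP.υ₂_pos, mul_comm]
    exact ((le_max_right _ _).trans (le_max_left _ _)).trans ((hmem k).1 hk)
  refine ⟨hreach, hδanti, hδlim, hinf, hGlim, fun z hz y _ => ?_⟩
  -- The aggregate cut evaluated at `y` lies below `f y`; both error terms vanish along shrinking
  -- iterations with `x k` near `z`.
  have hcut : ∀ k, f (T.x k) ≤ f y + (f (T.x k) - l k)
      + ‖T.Gω f P k‖ * (‖y - T.x k‖ + ‖T.s f P k‖) := fun k => by
    have h1 := (hB k).model_add_inner_comb_le hN (hW k) (hδ k) (hret k).1 (y - T.x k)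
    have h2 := (hB k).model_le_self hf (hret k).1 (T.x k + (y - T.x k))
    rw [hpt] at h1
    rw [add_sub_cancel] at h1 h2
    have h3 : |(inner ℝ (T.Gω f P k) (y - T.x k - T.s f P k) : ℝ)|
        ≤ ‖T.Gω f P k‖ * (‖y - T.x k‖ + ‖T.s f P k‖) :=
      (abs_real_inner_le_norm _ _).trans
        (mul_le_mul_of_nonneg_left (norm_sub_le _ _) (norm_nonneg _))
    have h4 : l k + inner ℝ (T.Gω f P k) (y - T.x k - T.s f P k)
      ≤ (T.B k).model f (T.last f P k) y := h1
    linarith [(abs_le.1 h3).1]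
  -- An ultrafilter plays the role of a subsequence with `x k → z`.
  obtain ⟨U, hU, hUx⟩ := mapClusterPt_iff_ultrafilter.1 hz
  have hUtop : (U : Filter ℕ) ≤ atTop := hU.trans inf_le_left
  have hright := ((hgap.mono_left hUtop).const_add (f y)).add ((hGlim.mono_left hU).mul
    ((hUx.const_sub y).norm.add (hslim.mono_left hU)))
  rw [add_zero, zero_mul, add_zero] at hright
  exact le_of_tendsto_of_tendsto' (((continuous_of_convexOn_univ hf).tendsto z).comp hUx)
    hright hcut

end Trace.IsRun

end SVANO

theorem mainTheorem1 {n : ℕ} (f : SVANO.Vec n → ℝ)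
    (hconv : ConvexOn ℝ Set.univ f) (hbdd : BddBelow (Set.range f))
    (P : SVANO.Params n) (hP : P.Valid)
    (T : SVANO.Trace n) (hT : T.IsRun f P) :
    (∃ k, T.Reached f P k ∧ IsMinOn f Set.univ (T.x k)) ∨
    ((∀ k, T.Reached f P k) ∧
      Antitone T.δ ∧ Tendsto T.δ atTop (𝓝 0) ∧
      (T.shrinkSet P).Infinite ∧
      Tendsto (fun k => ‖T.Gω f P k‖) (atTop ⊓ 𝓟 (T.shrinkSet P)) (𝓝 0) ∧
      ∀ z : SVANO.Vec n, MapClusterPt z (atTop ⊓ 𝓟 (T.shrinkSet P)) T.x →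
        IsMinOn f Set.univ z) := by
  rw [or_iff_not_imp_left]
  intro h
  exact hT.convergence hconv hbdd hP fun k hk hm => h ⟨k, hk, hm⟩
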